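/- For integers $p,q\ge 1$ let $B_{p,q}=K_p\vee qK_1$ be the join of the complete graph $K_p$ with $q$ isolated vertices, and let $\mathcal G(n,p,q)$ be the set of graphs with the largest number of edges among all $n$-vertex graphs that are not $p$-partite and contain no subgraph isomorphic to $B_{p,q}$ (so $B_{p,1}=K_{p+1}$). Let $T_{n,p}$ be the complete $p$-partite graph on $n$ vertices whose part sizes are as equal as possible, and write $e(G)$ for the number of edges of $G$. For $p\ge 2$ and sufficiently large $n$, let $T_1,\dots,T_p$ be the parts of $T_{n-1,p}$ with $|T_1|\le|T_2|\le\cdots\le|T_p|$, let $u_1\in T_1$ and $u_2\in T_2$, and let $Y_p(n)$ be the graph obtained from $T_{n-1,p}$ by deleting the edge $u_1u_2$ and adding a new vertex $u_0$ adjacent exactly to $u_1$, $u_2$ and all vertices of $T_3\cup\dots\cup T_p$. **Theorem.** Let $p\ge 3$ and $q\ge 1$. There is $N=N(p,q)$ such that for all $n\ge N$: $$Y_p(n)\in\mathcal G(n,p,1)\subseteq\mathcal G(n,p,q),$$ and every $G\in\mathcal G(n,p,q)$ has exactly $e(G)=e(T_{n,p})-\lfloor n/p\rfloor+1$ edges.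 In particular, $Y_p(n)\in\mathcal G(n,p,q)$, so $Y_p(n)$ attains the maximum number of edges among the $n$-vertex non-$p$-partite $B_{p,q}$-free graphs. -/

import Mathlib

/-- The join `G ∨ H`: disjoint copies of `G` and `H` together with all edges between them. -/
def graphJoin {V W : Type*} (G : SimpleGraph V) (H : SimpleGraph W) : SimpleGraph (V ⊕ W) where
  Adj
    | Sum.inl u, Sum.inl v => G.Adj u v
    | Sum.inr u, Sum.inr v => H.Adj u v
    | Sum.inl _, Sum.inr _ => True
    | Sum.inr _, Sum.inl _ => True
  symm := ⟨by
    rintro (u | u) (v | v) h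
    · exact G.adj_symm h
    · trivial
    · trivial
    · exact H.adj_symm h⟩
  loopless := ⟨by
    rintro (u | u) h
    · exact G.loopless.irrefl u h
    · exact H.loopless.irrefl u h⟩

/-- The generalized book (complete split graph) `B_{p,q} = K_p ∨ q K_1`. -/
def bookGraph (p q : ℕ) : SimpleGraph (Fin p ⊕ Fin q) :=
  graphJoin (⊤ : SimpleGraph (Fin p)) (⊥ : SimpleGraph (Fin q))

/-- The number of edges of a graph on `n` vertices. -/
noncomputable def numEdges {V : Type*} (G : SimpleGraph V) : ℕ := G.edgeSet.ncard

/-- The `n`-vertex graphs that are not `p`-partite and contain no (not necessarily induced)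
copy of `B_{p,q}`. -/
def admissible (n p q : ℕ) : Set (SimpleGraph (Fin n)) :=
  {G | ¬ G.Colorable p ∧ (bookGraph p q).Free G}

/-- The set `𝒢(n,p,q)` of graphs with the largest number of edges among all `n`-vertex
non-`p`-partite `B_{p,q}`-free graphs. -/
def extremalSet (n p q : ℕ) : Set (SimpleGraph (Fin n)) :=
  {G | G ∈ admissible n p q ∧ ∀ H ∈ admissible n p q, numEdges H ≤ numEdges G}

/-- The size of the colour class of `T_{m,p}` (`SimpleGraph.turanGraph m p`, whose colour classes
are the residue classes mod `p`) that contains the vertex `v`. -/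
def classSize (p : ℕ) {m : ℕ} (v : Fin m) : ℕ :=
  (Finset.univ.filter fun w : Fin m => (w : ℕ) % p = (v : ℕ) % p).card

/-- The Turán graph `T_{m,p}` with the edge `u₁u₂` removed, and a new vertex `u₀ = none` joined to
`u₁`, to `u₂`, and to all vertices outside the colour classes of `u₁` and `u₂`. -/
def yGraph (p : ℕ) {m : ℕ} (u₁ u₂ : Fin m) : SimpleGraph (Option (Fin m)) where
  Adj
    | some v, some w => (SimpleGraph.turanGraph m p).Adj v w ∧ s(v, w) ≠ s(u₁, u₂)
    | none, some w => w = u₁ ∨ w = u₂ ∨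
        ((w : ℕ) % p ≠ (u₁ : ℕ) % p ∧ (w : ℕ) % p ≠ (u₂ : ℕ) % p)
    | some w, none => w = u₁ ∨ w = u₂ ∨
        ((w : ℕ) % p ≠ (u₁ : ℕ) % p ∧ (w : ℕ) % p ≠ (u₂ : ℕ) % p)
    | none, none => False
  symm := ⟨by
    rintro (_ | v) (_ | w) h
    · exact h
    · exact h
    · exact h
    · exact ⟨h.1.symm, fun e => h.2 (Sym2.eq_swap.trans e)⟩⟩
  loopless := ⟨by
    rintro (_ | v) h
    · exact h
    · exact (SimpleGraph.turanGraph m p).loopless.irrefl v h.1⟩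

/-- `G` is (isomorphic to) `Y_p(n)`: the graph `yGraph p u₁ u₂` built from `T_{n-1,p}`, where `u₁`
lies in a smallest colour class `T₁` and `u₂` in a smallest one `T₂` among the others. -/
def IsY (p n : ℕ) (G : SimpleGraph (Fin n)) : Prop :=
  ∃ u₁ u₂ : Fin (n - 1),
    (u₁ : ℕ) % p ≠ (u₂ : ℕ) % p ∧
    classSize p u₁ ≤ classSize p u₂ ∧
    (∀ w : Fin (n - 1), (w : ℕ) % p ≠ (u₁ : ℕ) % p → classSize p u₂ ≤ classSize p w) ∧
    Nonempty (G ≃g yGraph p u₁ u₂)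

/-!
Write `t(n)` for the number of edges of the Turán graph `T_{n,p}`. The point is the upper bound
`e(G) ≤ t(n) - ⌊n/p⌋ + 1` for every large non-`p`-partite `B_{p,q}`-free graph `G`
(`exists_numEdges_add_le_of_book_free`). The graph `Y_p(n)` attains it, is not `p`-partite and is
even `K_{p+1}`-free (`isY_spec`), so the bound is the extremal number both for `q` and for `1`.

*Graphs containing `K_{p+1}`.* Every clique on `p` vertices has fewer than `q` common neighbours, so
the `p + 1` vertices of a clique have total degree at most `(p - 1)n + O(1)`, whereas
`t(n) - t(n - p - 1)` is about `(p - 1/p)n`. Deleting such cliques shows that a `B_{p,q}`-free graph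
has at most `t(n) + O(1)` edges, and that it has at most `t(n) - (1 - 1/p)n + O(1)` if it contains a
`K_{p+1}`. For `p ≥ 3` this is below `t(n) - n/p`
(`exists_numEdges_add_div_le_of_not_cliqueFree`).

*`K_{p+1}`-free graphs.* If deleting a vertex `v` leaves a `p`-partite graph, then the neighbourhood
of `v` meets all classes of any `p`-colouring of the rest but contains no transversal clique. Double
counting the transversals shows that at least `a₀a₁` pairs between its classes are missing, where
`a₀` and `a₁` are the two smallest class sizes (`le_card_missing_of_no_transversal`), and convexity
gives the bound for every `n` (`numEdges_add_card_add_le`). Otherwise, by the Andrásfai–Erdős–Sós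
theorem, some vertex has degree smaller than the increment of the bound, so that deleting it
increases the surplus over the bound. Since the surplus at bounded order is bounded, there is none
at large order (`exists_numEdges_add_le_of_cliqueFree`).
-/

open Finset

/-! ### Edge counts -/

theorem numEdges_eq_card_edgeFinset {V : Type*} [Fintype V] (G : SimpleGraph V)
    [Fintype G.edgeSet] : numEdges G = #G.edgeFinset := by
  rw [numEdges, Set.ncard_eq_toFinset_card', SimpleGraph.edgeFinset]

open Classical in
theorem two_mul_numEdges {V : Type*} [Fintype V] (G : SimpleGraph V) :
    2 * numEdges G = ∑ v, ∑ w, if G.Adj v w then 1 else 0 := by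
  rw [numEdges_eq_card_edgeFinset, ← G.sum_degrees_eq_twice_card_edges]
  refine Finset.sum_congr rfl fun v _ => ?_
  rw [← SimpleGraph.card_neighborFinset_eq_degree, SimpleGraph.neighborFinset_eq_filter,
    Finset.card_filter]

theorem numEdges_le_sq {V : Type*} [Fintype V] (G : SimpleGraph V) :
    2 * numEdges G ≤ Fintype.card V ^ 2 := by
  classical
  rw [two_mul_numEdges]
  calc _ ≤ ∑ _v : V, ∑ _w : V, 1 := by gcongr; split_ifs <;> simp
    _ = _ := by simp [sq]

theorem numEdges_congr {V W : Type*} {G : SimpleGraph V} {H : SimpleGraph W} (e : G ≃g H) :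
    numEdges G = numEdges H := by
  rw [numEdges, numEdges, ← Nat.card_coe_set_eq, ← Nat.card_coe_set_eq]
  exact Nat.card_congr e.mapEdgeSet

open Classical in
/-- Deleting the vertices of `K` destroys at most as many edges as the sum of their degrees. -/
theorem numEdges_le_induce_compl_add {V : Type*} [Fintype V] (G : SimpleGraph V) (K : Finset V) :
    numEdges G ≤ numEdges (G.induce (K : Set V)ᶜ) + ∑ x ∈ K, G.degree x := by
  have hd : ∀ v, G.degree v = ∑ w, if G.Adj v w then 1 else 0 := fun v => by
    rw [← SimpleGraph.card_neighborFinset_eq_degree, SimpleGraph.neighborFinset_eq_filter,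
      Finset.card_filter]
  have hi : 2 * numEdges (G.induce (K : Set V)ᶜ) =
      ∑ v ∈ Kᶜ, ∑ w ∈ Kᶜ, if G.Adj v w then 1 else 0 := by
    have key : ∀ f : V → ℕ, ∑ v : ↥((K : Set V)ᶜ), f v = ∑ v ∈ Kᶜ, f v :=
      fun f => (Finset.sum_subtype Kᶜ (by simp) f).symm
    rw [two_mul_numEdges, ← key]
    exact Finset.sum_congr rfl fun v _ => key fun w => if G.Adj v w then 1 else 0
  have h1 := two_mul_numEdges G
  rw [← Finset.sum_add_sum_compl K] at h1
  have h2 : ∑ v ∈ Kᶜ, (∑ w, if G.Adj v w then 1 else 0) =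
      ∑ v ∈ Kᶜ, (∑ w ∈ K, if G.Adj v w then 1 else 0) +
      ∑ v ∈ Kᶜ, (∑ w ∈ Kᶜ, if G.Adj v w then 1 else 0) := by
    rw [← Finset.sum_add_distrib]
    exact Finset.sum_congr rfl fun v _ => (Finset.sum_add_sum_compl K _).symm
  have h3 : ∑ v ∈ Kᶜ, (∑ w ∈ K, if G.Adj v w then 1 else 0) ≤ ∑ x ∈ K, G.degree x := by
    rw [Finset.sum_comm]
    refine Finset.sum_le_sum fun x _ => ?_
    rw [hd]
    simp_rw [G.adj_comm _ x]
    exact Finset.sum_le_sum_of_subset (Finset.subset_univ _)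
  simp_rw [← hd] at h1 h2
  omega

/-! ### The Turán number -/

/-- The number of edges of `T_{n,p}` in terms of `m = ⌊n/p⌋`. It says that the squares of the class
sizes add up to `(2m + 1)n - pm(m + 1)`: every class size is `m` or `m + 1`, hence a root of
`s² = (2m + 1)s - m(m + 1)`. -/
theorem two_mul_numEdges_turanGraph {p : ℕ} (hp : 0 < p) (n : ℕ) :
    2 * numEdges (SimpleGraph.turanGraph n p) + (2 * (n / p) + 1) * n =
      n ^ 2 + p * (n / p) * (n / p + 1) := by
  induction n using Nat.strong_induction_on with
  | _ n ih =>
  by_cases hn : n < p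
  · rw [Nat.div_eq_of_lt hn, numEdges_eq_card_edgeFinset]
    have h : #(SimpleGraph.turanGraph n p).edgeFinset = n.choose 2 := by
      rw [SimpleGraph.card_edgeFinset_turanGraph, Nat.mod_eq_of_lt hn]; simp
    have h2 := Nat.triangle_succ (n - 1)
    rw [h, Nat.choose_two_right]
    have := Nat.div_mul_cancel (Nat.even_mul_pred_self n).two_dvd
    rcases n with _ | n
    · simp
    · simp only [Nat.add_sub_cancel] at this ⊢
      nlinarith
  · obtain ⟨k, rfl⟩ : ∃ k, n = k + p := ⟨n - p, by omega⟩
    have h := ih k (by omega)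
    rw [numEdges_eq_card_edgeFinset] at h ⊢
    rw [SimpleGraph.card_edgeFinset_turanGraph_add, Nat.add_div_right _ hp]
    have := Nat.div_mul_cancel (Nat.even_mul_pred_self p).two_dvd
    rw [Nat.choose_two_right]
    obtain ⟨r, rfl⟩ : ∃ r, p = r + 1 := ⟨p - 1, by omega⟩
    simp only [Nat.add_sub_cancel] at this ⊢
    nlinarith

theorem numEdges_turanGraph_succ {p : ℕ} (hp : 0 < p) (n : ℕ) :
    numEdges (SimpleGraph.turanGraph (n + 1) p) + n / p =
      numEdges (SimpleGraph.turanGraph n p) + n := by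
  have h1 := two_mul_numEdges_turanGraph hp n
  have h2 := two_mul_numEdges_turanGraph hp (n + 1)
  rw [Nat.succ_div] at h2
  split_ifs at h2 with h
  · obtain ⟨k, hk⟩ := h
    have hk0 : 0 < k := by rcases k with _ | k <;> omega
    obtain ⟨j, rfl⟩ : ∃ j, k = j + 1 := ⟨k - 1, by omega⟩
    have : n / p = j := by
      have hk' : n + 1 = j * p + p := by rw [hk]; ring
      rw [Nat.div_eq_iff hp]
      constructor <;> omega
    rw [this] at h1 h2 ⊢
    zify at *
    nlinarith
  · rw [add_zero] at h2
    nlinarith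

/-- Turán's theorem. -/
theorem numEdges_le_turanGraph {p : ℕ} {V : Type*} [Fintype V] {G : SimpleGraph V}
    (hG : G.CliqueFree (p + 1)) :
    numEdges G ≤ numEdges (SimpleGraph.turanGraph (Fintype.card V) p) := by
  classical
  rw [numEdges_eq_card_edgeFinset, numEdges_eq_card_edgeFinset,
    SimpleGraph.card_edgeFinset_turanGraph]
  exact hG.card_edgeFinset_le

theorem mul_numEdges_turanGraph_le {p : ℕ} (n : ℕ) :
    2 * p * numEdges (SimpleGraph.turanGraph n p) ≤ (p - 1) * n ^ 2 := by
  rw [numEdges_eq_card_edgeFinset]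
  exact SimpleGraph.mul_card_edgeFinset_turanGraph_le

theorem le_mul_numEdges_turanGraph {p : ℕ} (hp : 0 < p) (n : ℕ) :
    (p - 1) * n ^ 2 ≤ 2 * p * numEdges (SimpleGraph.turanGraph n p) + p ^ 2 := by
  have h := two_mul_numEdges_turanGraph hp n
  have h1 := Nat.div_add_mod n p
  have h2 := Nat.mod_lt n hp
  obtain ⟨r, rfl⟩ : ∃ r, p = r + 1 := ⟨p - 1, by omega⟩
  simp only [Nat.add_sub_cancel]
  generalize n / (r + 1) = m at *
  generalize n % (r + 1) = s at *
  generalize numEdges (SimpleGraph.turanGraph n (r + 1)) = t at *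
  subst h1
  zify at *
  have h3 : (r + 1 : ℤ) * s ≤ (r + 1) ^ 2 := by nlinarith
  have h4 : (0:ℤ) ≤ s ^ 2 := by positivity
  have h5 : (r + 1 : ℤ) * (2 * t) = (r + 1) * (((r + 1) * m + s) ^ 2 + (r + 1) * m * (m + 1)
    - (2 * m + 1) * ((r + 1) * m + s)) := by rw [← h]; ring
  linarith

/-! ### Books and cliques -/

/-- In a `B_{p,q}`-free graph, a clique on `p` vertices has fewer than `q` common neighbours. -/
theorem card_common_neighbors_lt_of_book_free {p q : ℕ} {V : Type*} {G : SimpleGraph V}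
    (hG : (bookGraph p q).Free G) {K : Finset V} (hK : G.IsNClique p K)
    {S : Finset V} (hS : ∀ v ∈ S, ∀ y ∈ K, G.Adj v y) : #S < q := by
  by_contra! hc
  obtain ⟨T, hTS, hT⟩ := Finset.exists_subset_card_eq hc
  let f := (K.equivFinOfCardEq hK.card_eq).symm
  let g := (T.equivFinOfCardEq hT).symm
  have ht : ∀ i j, G.Adj (g i) (f j) := fun i j => hS _ (hTS (g i).2) _ (f j).2
  refine hG ⟨⟨⟨Sum.elim (fun i => (f i : V)) (fun j => (g j : V)), ?_⟩, ?_⟩⟩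
  · rintro (i | i) (j | j) h
    · exact hK.isClique (f i).2 (f j).2 fun e =>
        SimpleGraph.Adj.ne (G := ⊤) h (f.injective (Subtype.ext e))
    · exact (ht j i).symm
    · exact ht i j
    · exact h.elim
  · rintro (i | i) (j | j) h
    · exact congrArg _ (f.injective (Subtype.ext h))
    · exact ((ht j i).ne h.symm).elim
    · exact ((ht i j).ne h).elim
    · exact congrArg _ (g.injective (Subtype.ext h))

theorem book_free_of_cliqueFree {p q : ℕ} (hq : 1 ≤ q) {V : Type*} {G : SimpleGraph V}
    (hG : G.CliqueFree (p + 1)) : (bookGraph p q).Free G := by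
  rintro ⟨f⟩
  rw [SimpleGraph.cliqueFree_iff] at hG
  let φ : Fin (p + 1) → Fin p ⊕ Fin q := Fin.snoc (α := fun _ => Fin p ⊕ Fin q) Sum.inl
    (Sum.inr ⟨0, hq⟩)
  have hφ : ∀ i j, i ≠ j → (bookGraph p q).Adj (φ i) (φ j) := by
    intro i j
    refine Fin.lastCases ?_ (fun i => ?_) i <;> refine Fin.lastCases ?_ (fun j => ?_) j <;>
      intro hij
    · exact (hij rfl).elim
    · simp only [φ, Fin.snoc_last, Fin.snoc_castSucc]; trivial
    · simp only [φ, Fin.snoc_last, Fin.snoc_castSucc]; trivial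
    · simp only [φ, Fin.snoc_castSucc]
      exact fun h : i = j => hij (h ▸ rfl)
  have hadj : ∀ i j, i ≠ j → G.Adj (f (φ i)) (f (φ j)) := fun i j h => f.toHom.map_adj (hφ i j h)
  exact hG.elim ⟨⟨fun i => f (φ i), fun {i j} h => hadj i j h.ne⟩, fun i j h => by
    by_contra hij
    exact (hadj i j hij).ne h⟩

theorem cliqueFree_of_book_one_free {p : ℕ} {V : Type*} {G : SimpleGraph V}
    (hG : (bookGraph p 1).Free G) : G.CliqueFree (p + 1) := by
  classical
  intro K hK
  obtain ⟨x, hx⟩ : K.Nonempty := by rw [← Finset.card_pos, hK.card_eq]; omega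
  have := card_common_neighbors_lt_of_book_free hG (K := K.erase x) (S := {x})
    ⟨hK.isClique.subset (by simp),
      by rw [Finset.card_erase_of_mem hx, hK.card_eq]; rfl⟩
    (by
      intro v hv y hy
      rw [Finset.mem_singleton] at hv
      subst hv
      exact hK.isClique hx (Finset.mem_of_mem_erase hy) (Finset.ne_of_mem_erase hy).symm)
  simp at this

theorem book_free_induce {p q : ℕ} {V : Type*} {G : SimpleGraph V}
    (hG : (bookGraph p q).Free G) (s : Set V) : (bookGraph p q).Free (G.induce s) :=
  fun h => hG (h.trans ⟨SimpleGraph.Copy.induce G s⟩)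

open Classical in
/-- In a `B_{p,q}`-free graph, all but boundedly many vertices have at most `p - 1` neighbours in a
given clique on `p + 1` vertices, because the others are common neighbours of `p` of its
vertices. -/
theorem sum_degree_clique_le {p q : ℕ} (hp : 0 < p) {V : Type*} [Fintype V] {G : SimpleGraph V}
    (hG : (bookGraph p q).Free G) {K : Finset V} (hK : G.IsNClique (p + 1) K) :
    ∑ x ∈ K, G.degree x ≤ (p - 1) * Fintype.card V + 2 * ((p + 1) * q) := by
  let C : V → Finset V := fun x => {v | ∀ y ∈ K.erase x, G.Adj v y}
  have hC : ∀ x ∈ K, #(C x) ≤ q := fun x hx => by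
    refine (card_common_neighbors_lt_of_book_free hG (K := K.erase x) ?_ ?_).le
    · exact ⟨hK.isClique.subset (by simp),
        by rw [Finset.card_erase_of_mem hx, hK.card_eq]; rfl⟩
    · intro v hv
      simpa [C] using hv
  have hU : #(K.biUnion C) ≤ (p + 1) * q := by
    rw [← hK.card_eq]
    exact Finset.card_biUnion_le_card_mul _ _ _ hC
  have hsum : ∑ x ∈ K, G.degree x = ∑ v, #{x ∈ K | G.Adj v x} := by
    simp_rw [← SimpleGraph.card_neighborFinset_eq_degree, SimpleGraph.neighborFinset_eq_filter,
      Finset.card_filter]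
    rw [Finset.sum_comm]
    simp_rw [G.adj_comm]
  have hv : ∀ v, #{x ∈ K | G.Adj v x} ≤ (p - 1) + if v ∈ K.biUnion C then 2 else 0 := by
    intro v
    split_ifs with h
    · have := Finset.card_filter_le K fun x => G.Adj v x
      rw [hK.card_eq] at this
      omega
    · by_contra! hlt
      apply h
      -- A vertex with at least `p` neighbours in `K` misses at most one vertex of `K`.
      have h1 : #{x ∈ K | ¬ G.Adj v x} ≤ 1 := by
        have := Finset.card_filter_add_card_filter_not (s := K) fun x => G.Adj v x
        rw [hK.card_eq] at this
        omega
      obtain ⟨x, hx, hx'⟩ : ∃ x ∈ K, ∀ y ∈ K, ¬ G.Adj v y → y = x := by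
        rcases Finset.eq_empty_or_nonempty {x ∈ K | ¬ G.Adj v x} with h0 | ⟨x, hx⟩
        · obtain ⟨x, hx⟩ : K.Nonempty := by rw [← Finset.card_pos, hK.card_eq]; omega
          refine ⟨x, hx, fun y hy hn => ?_⟩
          exact absurd (Finset.mem_filter.2 ⟨hy, hn⟩) (by rw [h0]; simp)
        · exact ⟨x, (Finset.mem_filter.1 hx).1, fun y hy hn =>
            Finset.card_le_one.1 h1 _ (Finset.mem_filter.2 ⟨hy, hn⟩) _ hx⟩
      refine Finset.mem_biUnion.2 ⟨x, hx, Finset.mem_filter.2 ⟨Finset.mem_univ _, fun y hy => ?_⟩⟩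
      by_contra hn
      exact (Finset.ne_of_mem_erase hy) (hx' y (Finset.mem_of_mem_erase hy) hn)
  rw [hsum]
  calc _ ≤ ∑ v : V, ((p - 1) + if v ∈ K.biUnion C then 2 else 0) := Finset.sum_le_sum fun v _ => hv v
    _ = (p - 1) * Fintype.card V + 2 * #(K.biUnion C) := by
      rw [Finset.sum_add_distrib, Finset.sum_const, ← Finset.sum_filter, Finset.sum_const,
        Finset.filter_univ_mem]
      simp [mul_comm]
    _ ≤ _ := by gcongr

/-! ### Book-free graphs containing a large clique -/

/-- The term `2(p - 1)|V|` on the left is what deleting a clique `K` on `p + 1` vertices gains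
against the bound `(p - 1)n²/(2p)`: the vertices of `K` have total degree about `(p - 1)|V|`, while
the bound drops by about `(p - 1/p)|V|`. -/
theorem mul_numEdges_le_of_clique {p q M : ℕ} (hp : 0 < p) {V : Type*} [Fintype V]
    {G : SimpleGraph V} (hG : (bookGraph p q).Free G) {K : Finset V} (hK : G.IsNClique (p + 1) K)
    (hM : 2 * p * numEdges (G.induce (K : Set V)ᶜ) ≤
      (p - 1) * (Fintype.card V - (p + 1)) ^ 2 + M) :
    2 * p * numEdges G + 2 * (p - 1) * Fintype.card V ≤ (p - 1) * Fintype.card V ^ 2 + M +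
      ((p - 1) * (p + 1) ^ 2 + 4 * p * (p + 1) * q) := by
  classical
  have h1 := numEdges_le_induce_compl_add G K
  have h2 := sum_degree_clique_le hp hG hK
  have h3 : p + 1 ≤ Fintype.card V := hK.card_eq ▸ Finset.card_le_univ K
  obtain ⟨k, hk⟩ := Nat.exists_eq_add_of_le h3
  obtain ⟨r, rfl⟩ : ∃ r, p = r + 1 := ⟨p - 1, by omega⟩
  rw [hk] at h2 hM ⊢
  simp only [Nat.add_sub_cancel, Nat.add_sub_cancel_left] at h2 hM ⊢
  have h4 : 2 * (r + 1) * numEdges G ≤ 2 * (r + 1) * (numEdges (G.induce (K : Set V)ᶜ) +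
    (r * (r + 1 + 1 + k) + 2 * ((r + 1 + 1) * q))) := by gcongr; omega
  nlinarith

/-- A `B_{p,q}`-free graph exceeds the Turán bound `(p - 1)n²/(2p)` by at most a constant: as long as
the order is large, deleting a clique on `p + 1` vertices does not decrease the surplus, and
Turán's theorem applies once there is none. -/
theorem exists_mul_numEdges_le_of_book_free (p q : ℕ) (hp : 2 ≤ p) :
    ∃ M : ℕ, ∀ n : ℕ, ∀ (V : Type) [Fintype V] (G : SimpleGraph V), Fintype.card V = n →
      (bookGraph p q).Free G → 2 * p * numEdges G ≤ (p - 1) * n ^ 2 + M := by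
  set C := (p - 1) * (p + 1) ^ 2 + 4 * p * (p + 1) * q with hC
  refine ⟨p * C ^ 2, fun n => ?_⟩
  induction n using Nat.strong_induction_on with
  | _ n ih =>
  intro V _ G hn hG
  classical
  by_cases hf : G.CliqueFree (p + 1)
  · have := numEdges_le_turanGraph hf
    rw [hn] at this
    calc _ ≤ 2 * p * numEdges (SimpleGraph.turanGraph n p) := by gcongr
      _ ≤ (p - 1) * n ^ 2 := mul_numEdges_turanGraph_le n
      _ ≤ _ := by omega
  · simp only [SimpleGraph.CliqueFree, not_forall, not_not] at hf
    obtain ⟨K, hK⟩ := hf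
    by_cases hnC : n ≤ C
    · have := numEdges_le_sq G
      rw [hn] at this
      calc 2 * p * numEdges G = p * (2 * numEdges G) := by ring
        _ ≤ p * n ^ 2 := by gcongr
        _ ≤ p * C ^ 2 := by gcongr
        _ ≤ _ := by omega
    · have h3 : p + 1 ≤ Fintype.card V := hK.card_eq ▸ Finset.card_le_univ K
      have hc : Fintype.card ↥((K : Set V)ᶜ) = n - (p + 1) := by
        rw [Fintype.card_compl_set, hn]
        simp [hK.card_eq]
      have h := mul_numEdges_le_of_clique (by omega) hG hK (M := p * C ^ 2) (by
        rw [hn]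
        exact ih (n - (p + 1)) (by omega) _ _ hc (book_free_induce hG _))
      rw [hn, ← hC] at h
      have : 1 * n ≤ 2 * (p - 1) * n := by gcongr; omega
      omega

/-- A large `B_{p,q}`-free graph containing `K_{p+1}` has about `(1 - 1/p)n` edges fewer than the
Turán graph, which for `p ≥ 3` is more than the `n/p` in question. -/
theorem exists_numEdges_add_div_le_of_not_cliqueFree (p q : ℕ) (hp : 3 ≤ p) :
    ∃ N : ℕ, ∀ (V : Type) [Fintype V] (G : SimpleGraph V), N ≤ Fintype.card V →
      (bookGraph p q).Free G → ¬ G.CliqueFree (p + 1) →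
      numEdges G + Fintype.card V / p ≤
        numEdges (SimpleGraph.turanGraph (Fintype.card V) p) := by
  obtain ⟨M, hM⟩ := exists_mul_numEdges_le_of_book_free p q (by omega)
  set C := (p - 1) * (p + 1) ^ 2 + 4 * p * (p + 1) * q with hC
  refine ⟨M + C + p ^ 2, fun V _ G hn hG hf => ?_⟩
  classical
  simp only [SimpleGraph.CliqueFree, not_forall, not_not] at hf
  obtain ⟨K, hK⟩ := hf
  have hc : Fintype.card ↥((K : Set V)ᶜ) = Fintype.card V - (p + 1) := by
    rw [Fintype.card_compl_set]
    simp [hK.card_eq]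
  have h := mul_numEdges_le_of_clique (by omega) hG hK (hM _ _ _ hc (book_free_induce hG _))
  have h2 := le_mul_numEdges_turanGraph (p := p) (by omega) (Fintype.card V)
  rw [← hC] at h
  generalize Fintype.card V = n at *
  have h3 : p * (n / p) ≤ n := Nat.mul_div_le n p
  have h4 : 4 * n ≤ 2 * (p - 1) * n := Nat.mul_le_mul_right n (by omega)
  refine Nat.le_of_mul_le_mul_left (c := 2 * p) ?_ (by omega)
  have h5 : 2 * p * (numEdges G + n / p) = 2 * p * numEdges G + 2 * (p * (n / p)) := by ring
  rw [h5]
  omega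

/-! ### Missing edges in a multipartite graph without transversal cliques -/

/-- In a family of nonempty classes `A i` such that every transversal contains a non-adjacent pair,
the number of non-adjacent pairs is at least the smallest product of two class sizes. -/
theorem le_card_missing_of_no_transversal {ι W : Type*} [Fintype ι] [LinearOrder ι]
    [DecidableEq W] {H : SimpleGraph W} [DecidableRel H.Adj] {A : ι → Finset W}
    {c : W → ι} (hc : ∀ i, ∀ x ∈ A i, c x = i) (hne : ∀ i, (A i).Nonempty)
    (hT : ∀ f : ι → W, (∀ i, f i ∈ A i) → ∃ i j, i ≠ j ∧ ¬ H.Adj (f i) (f j))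
    {i₀ i₁ : ι} (hmin : ∀ i j, i ≠ j → #(A i₀) * #(A i₁) ≤ #(A i) * #(A j))
    {M : Finset (W × W)}
    (hM : ∀ i j x y, i < j → x ∈ A i → y ∈ A j → ¬ H.Adj x y → (x, y) ∈ M)
    (hM' : ∀ z ∈ M, c z.1 < c z.2 ∧ z.1 ∈ A (c z.1) ∧ z.2 ∈ A (c z.2)) :
    #(A i₀) * #(A i₁) ≤ #M := by
  -- `F z` contains all transversals through the two vertices of the pair `z`.
  let F : W × W → Finset (ι → W) := fun z => Fintype.piFinset fun k =>
    if k = c z.1 then {z.1} else if k = c z.2 then {z.2} else A k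
  have hF : ∀ z ∈ M, #(F z) * (#(A i₀) * #(A i₁)) ≤ ∏ k, #(A k) := by
    intro z hz
    obtain ⟨hlt, h1, h2⟩ := hM' z hz
    have hcard : #(F z) = ∏ k ∈ (univ.erase (c z.1)).erase (c z.2), #(A k) := by
      rw [Fintype.card_piFinset, ← Finset.mul_prod_erase univ _ (Finset.mem_univ (c z.1)),
        ← Finset.mul_prod_erase _ _ (Finset.mem_erase.2 ⟨hlt.ne', Finset.mem_univ (c z.2)⟩)]
      rw [if_pos rfl, if_neg hlt.ne', if_pos rfl, Finset.card_singleton, Finset.card_singleton,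
        one_mul, one_mul]
      refine Finset.prod_congr rfl fun k hk => ?_
      simp only [Finset.mem_erase] at hk
      rw [if_neg hk.2.1, if_neg hk.1]
    rw [← Finset.mul_prod_erase univ _ (Finset.mem_univ (c z.1)),
      ← Finset.mul_prod_erase _ _ (Finset.mem_erase.2 ⟨hlt.ne', Finset.mem_univ (c z.2)⟩),
      hcard, ← mul_assoc (#(A (c z.1))), mul_comm]
    exact Nat.mul_le_mul_right _ (hmin _ _ hlt.ne)
  have hcov : Fintype.piFinset A ⊆ M.biUnion F := by
    have key : ∀ f : ι → W, (∀ i, f i ∈ A i) → ∀ i j, i < j → ¬ H.Adj (f i) (f j) →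
        f ∈ M.biUnion F := by
      intro f hf i j hij hn
      refine Finset.mem_biUnion.2 ⟨(f i, f j), hM i j _ _ hij (hf i) (hf j) hn, ?_⟩
      refine Fintype.mem_piFinset.2 fun k => ?_
      simp only [hc i _ (hf i), hc j _ (hf j)]
      split_ifs with h1 h2
      · simp [h1]
      · simp [h2]
      · exact hf k
    intro f hf
    rw [Fintype.mem_piFinset] at hf
    obtain ⟨i, j, hij, hn⟩ := hT f hf
    rcases lt_or_gt_of_ne hij with h | h
    · exact key f hf i j h hn
    · exact key f hf j i h fun h' => hn h'.symm
  have hpos : 0 < ∏ k, #(A k) := Finset.prod_pos fun k _ => Finset.card_pos.2 (hne k)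
  refine Nat.le_of_mul_le_mul_left (c := ∏ k, #(A k)) ?_ hpos
  calc (∏ k, #(A k)) * (#(A i₀) * #(A i₁))
      = #(Fintype.piFinset A) * (#(A i₀) * #(A i₁)) := by rw [Fintype.card_piFinset]
    _ ≤ (∑ z ∈ M, #(F z)) * (#(A i₀) * #(A i₁)) := by
        gcongr
        exact (Finset.card_le_card hcov).trans Finset.card_biUnion_le
    _ = ∑ z ∈ M, #(F z) * (#(A i₀) * #(A i₁)) := Finset.sum_mul _ _ _
    _ ≤ ∑ _z ∈ M, ∏ k, #(A k) := Finset.sum_le_sum hF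
    _ = _ := by rw [Finset.sum_const, smul_eq_mul, mul_comm]

/-! ### Adding one vertex to a multipartite graph -/

open Classical in
/-- Edges, missing pairs (counted in both orders) and monochromatic pairs are disjoint families of
ordered pairs. -/
theorem two_mul_numEdges_add_le {p : ℕ} {W : Type*} [Fintype W] {H : SimpleGraph W}
    {c : W → Fin p} (hc : ∀ x y, H.Adj x y → c x ≠ c y) {M : Finset (W × W)}
    (hM : ∀ z ∈ M, c z.1 < c z.2 ∧ ¬ H.Adj z.1 z.2) :
    2 * numEdges H + 2 * #M + ∑ i, #{w | c w = i} ^ 2 ≤ Fintype.card W ^ 2 := by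
  let E : Finset (W × W) := {z | H.Adj z.1 z.2}
  let S : Finset (W × W) := {z | c z.1 = c z.2}
  have hE : 2 * numEdges H = #E := by
    rw [two_mul_numEdges, Finset.card_filter, ← Finset.univ_product_univ, Finset.sum_product]
  have hS : ∑ i, #{w | c w = i} ^ 2 = #S := by
    rw [Finset.card_eq_sum_card_fiberwise (f := fun z => c z.1) (t := univ) (by simp)]
    refine Finset.sum_congr rfl fun i _ => ?_
    rw [sq, ← Finset.card_product]
    congr 1
    ext z
    simp only [S, Finset.mem_product, Finset.mem_filter, Finset.mem_univ, true_and]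
    constructor
    · rintro ⟨h1, h2⟩; exact ⟨h1.trans h2.symm, h1⟩
    · rintro ⟨h1, h2⟩; exact ⟨h2, h1.symm.trans h2⟩
  have hM2 : #(M.image Prod.swap) = #M := Finset.card_image_of_injective _ Prod.swap_injective
  have hd1 : Disjoint M (M.image Prod.swap) := by
    rw [Finset.disjoint_left]
    intro z hz hz'
    obtain ⟨y, hy, rfl⟩ := Finset.mem_image.1 hz'
    exact lt_asymm (hM _ hz).1 (hM _ hy).1
  have hd2 : Disjoint E (M ∪ M.image Prod.swap) := by
    rw [Finset.disjoint_left]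
    intro z hz hz'
    have hz : H.Adj z.1 z.2 := by simpa [E] using hz
    rcases Finset.mem_union.1 hz' with h | h
    · exact (hM _ h).2 hz
    · obtain ⟨y, hy, rfl⟩ := Finset.mem_image.1 h
      exact (hM _ hy).2 hz.symm
  have hd3 : Disjoint (E ∪ (M ∪ M.image Prod.swap)) S := by
    rw [Finset.disjoint_left]
    intro z hz hz'
    have hz' : c z.1 = c z.2 := by simpa [S] using hz'
    rcases Finset.mem_union.1 hz with h | h
    · exact hc z.1 z.2 (by simpa [E] using h) hz'
    rcases Finset.mem_union.1 h with h | h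
    · exact (hM _ h).1.ne hz'
    · obtain ⟨y, hy, rfl⟩ := Finset.mem_image.1 h
      exact (hM _ hy).1.ne' hz'
  have := Finset.card_le_univ ((E ∪ (M ∪ M.image Prod.swap)) ∪ S)
  rw [Finset.card_union_of_disjoint hd3, Finset.card_union_of_disjoint hd2,
    Finset.card_union_of_disjoint hd1, hM2, Fintype.card_prod] at this
  rw [hE, hS, sq]
  omega

open Classical in
/-- A `p`-partite graph `H` and a set `S` of vertices, to be thought of as the neighbourhood of one
additional vertex. If `S` meets every colour class but contains no transversal clique, then `H`
together with the additional vertex has at most `e(T_{n,p}) - ⌊n/p⌋ + 1` edges, for every order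
`n = |W| + 1`.

Let `aᵢ` and `sᵢ` be the sizes of the `i`-th class within `S` and within `W`, and let `a₀a₁` be the
smallest product of two of the `aᵢ`. At least `a₀a₁ ≥ a₀ + a₁ - 1` pairs are missing, and
`|S| ≤ a₀ + a₁ + ∑_{i ≠ 0, 1} sᵢ`, so the count is at most `1 + ∑_{i < j} sᵢsⱼ + ∑_{i ≠ 0, 1} sᵢ`;
this is largest for balanced classes. -/
theorem numEdges_add_card_add_le {p : ℕ} (hp : 2 ≤ p) {W : Type*} [Fintype W]
    {H : SimpleGraph W} (C : H.Coloring (Fin p)) {S : Finset W}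
    (hS : ∀ i, ∃ w ∈ S, C w = i)
    (hT : ∀ f : Fin p → W, (∀ i, f i ∈ S ∧ C (f i) = i) → ∃ i j, i ≠ j ∧ ¬ H.Adj (f i) (f j)) :
    numEdges H + #S + (Fintype.card W + 1) / p ≤
      numEdges (SimpleGraph.turanGraph (Fintype.card W + 1) p) + 1 := by
  let A : Fin p → Finset W := fun i => {w ∈ S | C w = i}
  let P : Fin p → Finset W := fun i => {w | C w = i}
  have hA : ∀ i w, w ∈ A i ↔ w ∈ S ∧ C w = i := fun i w => by simp [A]
  have hne : ∀ i, (A i).Nonempty := fun i => by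
    obtain ⟨w, hw, hi⟩ := hS i
    exact ⟨w, (hA i w).2 ⟨hw, hi⟩⟩
  obtain ⟨⟨i₀, i₁⟩, h01, hmin⟩ := Finset.exists_min_image
    ((univ : Finset (Fin p × Fin p)).filter fun z => z.1 ≠ z.2) (fun z => #(A z.1) * #(A z.2))
    ⟨(⟨0, by omega⟩, ⟨1, by omega⟩), by simp⟩
  replace h01 : i₀ ≠ i₁ := by simpa using h01
  have hmin : ∀ i j, i ≠ j → #(A i₀) * #(A i₁) ≤ #(A i) * #(A j) := fun i j hij =>
    hmin (i, j) (by simpa using hij)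
  let M : Finset (W × W) := {z | z.1 ∈ S ∧ z.2 ∈ S ∧ C z.1 < C z.2 ∧ ¬ H.Adj z.1 z.2}
  have hMm : ∀ z, z ∈ M ↔ z.1 ∈ S ∧ z.2 ∈ S ∧ C z.1 < C z.2 ∧ ¬ H.Adj z.1 z.2 :=
    fun z => by simp [M]
  have hMc : #(A i₀) * #(A i₁) ≤ #M := by
    refine le_card_missing_of_no_transversal (H := H) (c := C) (fun i x hx => ((hA i x).1 hx).2)
      hne (fun f hf => hT f fun i => (hA i _).1 (hf i)) hmin ?_ ?_
    · intro i j x y hij hx hy hn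
      obtain ⟨hxS, rfl⟩ := (hA _ _).1 hx
      obtain ⟨hyS, rfl⟩ := (hA _ _).1 hy
      exact (hMm _).2 ⟨hxS, hyS, hij, hn⟩
    · intro z hz
      obtain ⟨h1, h2, h3, -⟩ := (hMm z).1 hz
      exact ⟨h3, (hA _ _).2 ⟨h1, rfl⟩, (hA _ _).2 ⟨h2, rfl⟩⟩
  have hcount := two_mul_numEdges_add_le (H := H) (c := C) (fun x y h => C.valid h) (M := M)
    fun z hz => ⟨((hMm z).1 hz).2.2.1, ((hMm z).1 hz).2.2.2⟩
  have hSsum : #S = ∑ i, #(A i) :=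
    Finset.card_eq_sum_card_fiberwise (f := C) (t := univ) (by simp)
  have hWsum : Fintype.card W = ∑ i, #(P i) :=
    Finset.card_eq_sum_card_fiberwise (f := C) (t := univ) (by simp)
  have hAP : ∀ i, #(A i) ≤ #(P i) := fun i => Finset.card_le_card fun w hw => by
    simp only [P, Finset.mem_filter, Finset.mem_univ, true_and]
    exact ((hA i w).1 hw).2
  have hA1 : ∀ i, 1 ≤ #(A i) := fun i => Finset.card_pos.2 (hne i)
  have htur := two_mul_numEdges_turanGraph (p := p) (by omega) (Fintype.card W + 1)
  change 2 * numEdges H + 2 * #M + ∑ i, #(P i) ^ 2 ≤ _ at hcount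
  generalize (Fintype.card W + 1) / p = m at *
  -- The square of a class size is at least the linear function agreeing with it at `m` and `m + 1`.
  -- For the classes `i₀` and `i₁`, the one agreeing with it at `m - 1` and `m` is used instead.
  have hpt : ∀ i, (2 * (m : ℤ) + 1) * #(P i) + 2 * #(A i) +
      (if i = i₀ then 2 * (m - #(A i₀) : ℤ) else 0) + (if i = i₁ then 2 * (m - #(A i₁) : ℤ) else 0)
      ≤ (#(P i) : ℤ) ^ 2 + 2 * #(P i) + m * (m + 1) := by
    intro i
    have ha : (#(A i) : ℤ) ≤ #(P i) := by exact_mod_cast hAP i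
    have hsq : ∀ a : ℤ, 0 ≤ a * (a + 1) := fun a => by
      rcases le_or_gt 0 a with h | h
      · positivity
      · exact mul_nonneg_of_nonpos_of_nonpos h.le (by omega)
    have h1 := hsq (#(P i) - m)
    have h2 := hsq (#(P i) - m - 1)
    by_cases hi0 : i = i₀
    · subst hi0
      rw [if_pos rfl, if_neg h01]
      nlinarith
    · rw [if_neg hi0]
      by_cases hi1 : i = i₁
      · subst hi1
        rw [if_pos rfl]
        nlinarith
      · rw [if_neg hi1]
        nlinarith
  have hsum := Finset.sum_le_sum fun i (_ : i ∈ univ) => hpt i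
  simp only [Finset.sum_add_distrib, ← Finset.mul_sum, Finset.sum_ite_eq', Finset.mem_univ,
    if_true, Finset.sum_const, Finset.card_univ, Fintype.card_fin, nsmul_eq_mul] at hsum
  have hprod : (0 : ℤ) ≤ (#(A i₀) - 1) * (#(A i₁) - 1) :=
    mul_nonneg (by have := hA1 i₀; omega) (by have := hA1 i₁; omega)
  zify at *
  rw [← hSsum, ← hWsum] at hsum
  nlinarith

/-! ### Clique-free graphs that are not `p`-partite -/

open Classical in
/-- Deleting one vertex from a non-`p`-partite graph: if the rest is `p`-partite, the edge bound
holds. -/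
theorem numEdges_add_le_of_colorable_induce {p : ℕ} (hp : 2 ≤ p) {V : Type*} [Fintype V]
    {G : SimpleGraph V} (hG : G.CliqueFree (p + 1)) (hcol : ¬ G.Colorable p) (v : V)
    (hv : (G.induce ((({v} : Finset V) : Set V)ᶜ)).Colorable p) :
    numEdges G + Fintype.card V / p ≤
      numEdges (SimpleGraph.turanGraph (Fintype.card V) p) + 1 := by
  obtain ⟨C⟩ := hv
  let S : Finset ↥((({v} : Finset V) : Set V)ᶜ) := {w | G.Adj v w}
  have hmem : ∀ w, w ≠ v → w ∈ ((({v} : Finset V) : Set V)ᶜ) := fun w hw => by simpa using hw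
  have hcard : Fintype.card ↥((({v} : Finset V) : Set V)ᶜ) + 1 = Fintype.card V := by
    rw [Fintype.card_compl_set]
    have : 0 < Fintype.card V := Fintype.card_pos_iff.2 ⟨v⟩
    simp
    omega
  have hdeg : G.degree v = #S := by
    rw [← SimpleGraph.card_neighborFinset_eq_degree]
    refine Finset.card_bij' (fun w hw => ⟨w, hmem w ?_⟩) (fun w _ => w) ?_ ?_ ?_ ?_
    · exact ((SimpleGraph.mem_neighborFinset _ _ _).1 hw).ne'
    · intro w hw
      simpa [S] using hw
    · intro w hw
      simpa [S] using hw
    · intros; rfl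
    · intros; rfl
  have hdel := numEdges_le_induce_compl_add G {v}
  rw [Finset.sum_singleton, hdeg] at hdel
  have hmain := numEdges_add_card_add_le hp C (S := S) ?_ ?_
  · rw [hcard] at hmain
    omega
  · -- Otherwise `v` could be given the missing colour.
    by_contra! h
    obtain ⟨i, hi⟩ := h
    refine hcol ⟨SimpleGraph.Coloring.mk
      (fun w => if h : w ≠ v then C ⟨w, hmem w h⟩ else i) ?_⟩
    intro x y hxy
    by_cases hx : x = v
    · subst hx
      rw [dif_neg (by simp), dif_pos hxy.ne']
      exact (hi ⟨y, hmem y hxy.ne'⟩ (by simpa [S] using hxy)).symm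
    · by_cases hy : y = v
      · subst hy
        rw [dif_pos hx, dif_neg (by simp)]
        exact hi ⟨x, hmem x hx⟩ (by simpa [S] using hxy.symm)
      · rw [dif_pos hx, dif_pos hy]
        exact C.valid hxy
  · -- A transversal clique in the neighbourhood of `v` would give a clique on `p + 1` vertices.
    intro f hf
    by_contra! h
    have hadj : ∀ i, G.Adj v (f i) := fun i => by simpa [S] using (hf i).1
    rw [SimpleGraph.cliqueFree_iff] at hG
    let φ : Fin (p + 1) → V := Fin.cons v fun i => (f i : V)
    have hφ : ∀ i j, i ≠ j → G.Adj (φ i) (φ j) := by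
      intro i j
      refine Fin.cases ?_ (fun i => ?_) i <;> refine Fin.cases ?_ (fun j => ?_) j <;> intro hij
      · exact (hij rfl).elim
      · exact hadj j
      · exact (hadj i).symm
      · exact h i j fun e => hij (e ▸ rfl)
    exact hG.elim ⟨⟨φ, fun {i j} e => hφ i j e.ne⟩, fun i j e => by
      by_contra hij
      exact (hφ i j hij).ne e⟩

/-- By the Andrásfai–Erdős–Sós theorem, a large `K_{p+1}`-free graph that is not `p`-partite has a
vertex whose degree is smaller than the minimum degree of the Turán graph. -/
theorem exists_degree_add_le {p : ℕ} (hp : 2 ≤ p) {V : Type*} [Fintype V] {G : SimpleGraph V}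
    [DecidableRel G.Adj] (hG : G.CliqueFree (p + 1)) (hcol : ¬ G.Colorable p)
    (hn : 2 * (p * (3 * p - 1)) ≤ Fintype.card V) :
    ∃ v, G.degree v + Fintype.card V / p + 2 ≤ Fintype.card V := by
  have hV : Nonempty V := by
    refine Fintype.card_pos_iff.1 (lt_of_lt_of_le ?_ hn)
    have : 0 < p * (3 * p - 1) := Nat.mul_pos (by omega) (by omega)
    omega
  obtain ⟨v, hv⟩ := G.exists_minimal_degree_vertex
  refine ⟨v, ?_⟩
  have h := mt (SimpleGraph.colorable_of_cliqueFree_lt_minDegree hG) hcol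
  rw [not_lt, hv] at h
  rw [Nat.le_div_iff_mul_le (by omega)] at h
  have h3 := Nat.mul_div_le (Fintype.card V) p
  generalize G.degree v = d at *
  generalize Fintype.card V = n at *
  generalize n / p = m at *
  obtain ⟨r, rfl⟩ : ∃ r, p = r + 2 := ⟨p - 2, by omega⟩
  rw [show 3 * (r + 2) - 4 = 3 * r + 2 by omega, show 3 * (r + 2) - 1 = 3 * r + 5 by omega] at *
  refine Nat.le_of_mul_le_mul_left (c := (r + 2) * (3 * r + 5)) ?_ (by positivity)
  nlinarith

/-- Induction on the number of vertices. Away from the `p`-partite case, deleting a vertex of small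
degree makes the surplus over the claimed bound grow, so a bounded surplus at bounded order forces
no surplus at large order. The truncated difference `M - n` vanishes for `n ≥ M`. -/
theorem exists_numEdges_add_le_of_cliqueFree (p : ℕ) (hp : 2 ≤ p) :
    ∃ M : ℕ, ∀ n : ℕ, ∀ (V : Type) [Fintype V] (G : SimpleGraph V), Fintype.card V = n →
      G.CliqueFree (p + 1) → ¬ G.Colorable p →
      numEdges G + n / p ≤ numEdges (SimpleGraph.turanGraph n p) + 1 + (M - n) := by
  set n₀ := 2 * (p * (3 * p - 1)) with hn₀
  refine ⟨n₀ + n₀ ^ 2 + n₀, fun n => ?_⟩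
  induction n with
  | zero =>
    intro V _ G hn _ hcol
    have := Fintype.card_eq_zero_iff.1 hn
    exact (hcol (SimpleGraph.Colorable.of_isEmpty p)).elim
  | succ n ih =>
  intro V _ G hn hG hcol
  classical
  by_cases hlt : n + 1 < n₀
  · have h1 := numEdges_le_sq G
    have h2 : (n + 1) / p ≤ n + 1 := Nat.div_le_self _ _
    have h3 : (n + 1) ^ 2 ≤ n₀ ^ 2 := by gcongr
    rw [hn] at h1
    omega
  · obtain ⟨v, hv⟩ := exists_degree_add_le hp hG hcol (by omega)
    by_cases hc : (G.induce ((({v} : Finset V) : Set V)ᶜ)).Colorable p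
    · have := numEdges_add_le_of_colorable_induce hp hG hcol v hc
      rw [hn] at this
      omega
    · have hcard : Fintype.card ↥((({v} : Finset V) : Set V)ᶜ) = n := by
        rw [Fintype.card_compl_set, hn]
        simp
      have h1 := ih _ _ hcard (hG.comap ⟨SimpleGraph.Copy.induce G _⟩) hc
      have h2 := numEdges_le_induce_compl_add G {v}
      rw [Finset.sum_singleton] at h2
      have h3 := numEdges_turanGraph_succ (p := p) (by omega) n
      rw [hn] at hv
      omega

/-- The upper bound on the number of edges. -/
theorem exists_numEdges_add_le_of_book_free (p q : ℕ) (hp : 3 ≤ p) :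
    ∃ N : ℕ, ∀ n : ℕ, N ≤ n → ∀ G ∈ admissible n p q,
      numEdges G + n / p ≤ numEdges (SimpleGraph.turanGraph n p) + 1 := by
  obtain ⟨N, hN⟩ := exists_numEdges_add_div_le_of_not_cliqueFree p q hp
  obtain ⟨M, hM⟩ := exists_numEdges_add_le_of_cliqueFree p (by omega)
  refine ⟨N + M, fun n hn G hG => ?_⟩
  by_cases hf : G.CliqueFree (p + 1)
  · have := hM n (Fin n) G (Fintype.card_fin n) hf hG.1
    omega
  · have := hN (Fin n) G (by rw [Fintype.card_fin]; omega) hG.2 hf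
    rw [Fintype.card_fin] at this
    omega

/-! ### The graph `Y_p(n)` -/

/-- The residue classes below `m % p` are those with one vertex more. -/
theorem classSize_eq {p : ℕ} (hp : 0 < p) {m : ℕ} (v : Fin m) :
    classSize p v = m / p + if (v : ℕ) % p < m % p then 1 else 0 := by
  rw [← Nat.count_modEq_card m hp v, Nat.count_eq_card_filter_range, classSize]
  refine Finset.card_bij (fun w _ => (w : ℕ)) ?_ ?_ ?_
  · intro w hw
    simp only [Finset.mem_filter, Finset.mem_univ, true_and] at hw
    exact Finset.mem_filter.2 ⟨Finset.mem_range.2 w.2, hw⟩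
  · intro a _ b _ h
    exact Fin.ext h
  · intro b hb
    simp only [Finset.mem_filter, Finset.mem_range] at hb
    exact ⟨⟨b, hb.1⟩, by simpa [Nat.ModEq] using hb.2, rfl⟩

/-- A clique on `p + 1` vertices would contain both `u₁` and `u₂`, which are not adjacent. -/
theorem cliqueFree_yGraph {p m : ℕ} (hp : 0 < p) {u₁ u₂ : Fin m}
    (hu : (u₁ : ℕ) % p ≠ (u₂ : ℕ) % p) : (yGraph p u₁ u₂).CliqueFree (p + 1) := by
  intro K hK
  -- The colouring by residues, extended to the new vertex by the residue of `u`, is proper except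
  -- on the edge between `u` and the new vertex.
  have key : ∀ u : Fin m, (u = u₁ ∨ u = u₂) → some u ∈ K := by
    intro u hu'
    let φ : Option (Fin m) → ℕ := fun x => x.elim ((u : ℕ) % p) fun w => (w : ℕ) % p
    have hnone : ∀ w, (yGraph p u₁ u₂).Adj none (some w) → (w : ℕ) % p = (u : ℕ) % p → w = u := by
      rintro w (rfl | rfl | ⟨h1, h2⟩) hw
      · rcases hu' with rfl | rfl
        · rfl
        · exact (hu hw).elim
      · rcases hu' with rfl | rfl
        · exact (hu hw.symm).elim
        · rfl
      · rcases hu' with rfl | rfl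
        · exact (h1 hw).elim
        · exact (h2 hw).elim
    obtain ⟨x, hx, y, hy, hxy, he⟩ := Finset.exists_ne_map_eq_of_card_lt_of_maps_to
      (s := K) (t := Finset.range p) (f := φ) (by rw [hK.card_eq]; simp) (by
        rintro (_ | w) _
        · simpa [φ] using Nat.mod_lt _ hp
        · simpa [φ] using Nat.mod_lt _ hp)
    have hadj := hK.isClique hx hy hxy
    rcases x with _ | x <;> rcases y with _ | y
    · exact (hxy rfl).elim
    · exact hnone y hadj he.symm ▸ hy
    · exact hnone x hadj.symm he ▸ hx
    · exact (hadj.1 he).elim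
  have h1 := key u₁ (Or.inl rfl)
  have h2 := key u₂ (Or.inr rfl)
  have hne : (some u₁ : Option (Fin m)) ≠ some u₂ := fun h =>
    hu (congrArg (fun w : Fin m => (w : ℕ) % p) (Option.some.inj h))
  exact (hK.isClique h1 h2 hne).2 rfl

/-- A transversal avoiding `u₁` and `u₂` uses every colour once and forces `u₁` and `u₂` to have the
colours of their classes, which leaves no colour for the new vertex. -/
theorem not_colorable_yGraph {p m : ℕ} (hp : 2 ≤ p) (hm : 3 * p ≤ m) (u₁ u₂ : Fin m) :
    ¬ (yGraph p u₁ u₂).Colorable p := by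
  rintro ⟨C⟩
  -- `x i` is a vertex of residue `i` different from `u₁` and `u₂`.
  have hx : ∀ i : Fin p, ∃ w : Fin m, (w : ℕ) % p = i ∧ w ≠ u₁ ∧ w ≠ u₂ := by
    intro i
    have hi := i.2
    have h : ∀ k < 3, (k * p + i) % p = i ∧ k * p + i < m := fun k hk => by
      constructor
      · rw [Nat.mul_add_mod', Nat.mod_eq_of_lt hi]
      · have : k * p ≤ 2 * p := Nat.mul_le_mul_right p (by omega)
        omega
    by_contra! hcon
    have hc : ∀ k < 3, k * p + i = u₁ ∨ k * p + (i : ℕ) = u₂ := fun k hk => by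
      by_contra! hk'
      exact hk'.2 (congrArg Fin.val (hcon ⟨k * p + i, (h k hk).2⟩ (h k hk).1
        fun e => hk'.1 (congrArg Fin.val e)))
    have h0 := hc 0 (by omega)
    have h1 := hc 1 (by omega)
    have h2 := hc 2 (by omega)
    omega
  choose x hxi hx1 hx2 using hx
  have hadj : ∀ i j, i ≠ j → (yGraph p u₁ u₂).Adj (some (x i)) (some (x j)) := by
    intro i j hij
    refine ⟨?_, ?_⟩
    · change (x i : ℕ) % p ≠ (x j : ℕ) % p
      rw [hxi, hxi]
      exact fun e => hij (Fin.ext e)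
    · intro e
      rcases Sym2.eq_iff.1 e with ⟨h, -⟩ | ⟨h, -⟩
      · exact hx1 i h
      · exact hx2 i h
  have hinj : Function.Injective fun i => C (some (x i)) := fun i j h => by
    by_contra hij
    exact C.valid (hadj i j hij) h
  have hsurj := Finite.surjective_of_injective hinj
  have hlt : ∀ u : Fin m, (u : ℕ) % p < p := fun u => Nat.mod_lt _ (by omega)
  have hcol : ∀ u : Fin m, (u = u₁ ∨ u = u₂) →
      C (some u) = C (some (x ⟨(u : ℕ) % p, hlt u⟩)) := by
    intro u hu'
    obtain ⟨i, hi⟩ := hsurj (C (some u))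
    by_cases hiu : (i : ℕ) = (u : ℕ) % p
    · rw [← hi]
      have : i = ⟨(u : ℕ) % p, hlt u⟩ := Fin.ext hiu
      subst this
      rfl
    · refine (C.valid (v := some (x i)) (w := some u) ⟨?_, ?_⟩ hi).elim
      · change (x i : ℕ) % p ≠ (u : ℕ) % p
        rwa [hxi]
      · intro e
        rcases Sym2.eq_iff.1 e with ⟨h, -⟩ | ⟨h, -⟩
        · exact hx1 i h
        · exact hx2 i h
  obtain ⟨i, hi⟩ := hsurj (C none)
  by_cases h1 : (i : ℕ) = (u₁ : ℕ) % p
  · refine C.valid (v := none) (w := some u₁) (Or.inl rfl) ?_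
    rw [hcol u₁ (Or.inl rfl), ← hi]
    have : i = ⟨(u₁ : ℕ) % p, hlt u₁⟩ := Fin.ext h1
    rw [this]
  by_cases h2 : (i : ℕ) = (u₂ : ℕ) % p
  · refine C.valid (v := none) (w := some u₂) (Or.inr (Or.inl rfl)) ?_
    rw [hcol u₂ (Or.inr rfl), ← hi]
    have : i = ⟨(u₂ : ℕ) % p, hlt u₂⟩ := Fin.ext h2
    rw [this]
  · refine C.valid (v := none) (w := some (x i)) (Or.inr (Or.inr ?_)) hi.symm
    rw [hxi]
    exact ⟨h1, h2⟩

/-- One edge of `T_{m,p}` is lost, and the new vertex has degree `m + 2 - |T₁| - |T₂|`. -/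
theorem numEdges_yGraph_ge {p m : ℕ} {u₁ u₂ : Fin m} (hu : (u₁ : ℕ) % p ≠ (u₂ : ℕ) % p) :
    numEdges (SimpleGraph.turanGraph m p) + m + 1 ≤
      numEdges (yGraph p u₁ u₂) + classSize p u₁ + classSize p u₂ := by
  classical
  have hu' : u₁ ≠ u₂ := fun h => hu (h ▸ rfl)
  have h := two_mul_numEdges (yGraph p u₁ u₂)
  rw [Fintype.sum_option, Fintype.sum_option] at h
  simp_rw [Fintype.sum_option] at h
  rw [Finset.sum_add_distrib] at h
  have hsymm : ∑ v : Fin m, (if (yGraph p u₁ u₂).Adj (some v) none then 1 else 0) =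
      ∑ v : Fin m, (if (yGraph p u₁ u₂).Adj none (some v) then 1 else 0) := by
    simp_rw [(yGraph p u₁ u₂).adj_comm none]
  have hnew : m + 2 ≤ ∑ v : Fin m, (if (yGraph p u₁ u₂).Adj none (some v) then 1 else 0) +
      classSize p u₁ + classSize p u₂ := by
    rw [← Finset.card_filter]
    let X : Fin m → Finset (Fin m) := fun u => {w | (w : ℕ) % p = (u : ℕ) % p}
    have hX : ∀ u, u ∈ X u := fun u => by simp [X]
    have hcov : (univ : Finset (Fin m)) ⊆
        (univ.filter (fun v => (yGraph p u₁ u₂).Adj none (some v)) \ {u₁, u₂}) ∪ (X u₁ ∪ X u₂) := by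
      intro w _
      by_cases h1 : w ∈ X u₁
      · simp [h1]
      by_cases h2 : w ∈ X u₂
      · simp [h2]
      refine Finset.mem_union_left _ (Finset.mem_sdiff.2 ⟨?_, ?_⟩)
      · refine Finset.mem_filter.2 ⟨Finset.mem_univ _, Or.inr (Or.inr ?_)⟩
        simpa [X] using And.intro h1 h2
      · intro h
        rcases Finset.mem_insert.1 h with rfl | h
        · exact h1 (hX _)
        · rw [Finset.mem_singleton] at h
          subst h
          exact h2 (hX _)
    have h1 := (Finset.card_le_card hcov).trans (Finset.card_union_le _ _)
    have h2 := Finset.card_union_le (X u₁) (X u₂)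
    have hsub : ({u₁, u₂} : Finset (Fin m)) ⊆
        univ.filter fun v => (yGraph p u₁ u₂).Adj none (some v) := by
      intro w hw
      refine Finset.mem_filter.2 ⟨Finset.mem_univ _, ?_⟩
      rcases Finset.mem_insert.1 hw with rfl | h
      · exact Or.inl rfl
      · exact Or.inr (Or.inl (Finset.mem_singleton.1 h))
    have h3 := Finset.card_sdiff_add_card_eq_card hsub
    rw [Finset.card_pair hu'] at h3
    rw [Finset.card_univ, Fintype.card_fin] at h1
    change _ ≤ _ + #(X u₁) + #(X u₂)
    omega
  have hold : 2 * numEdges (SimpleGraph.turanGraph m p) ≤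
      ∑ v : Fin m, ∑ w : Fin m, (if (yGraph p u₁ u₂).Adj (some v) (some w) then 1 else 0) + 2 := by
    have hT : 2 * numEdges (SimpleGraph.turanGraph m p) =
        ∑ v : Fin m, ∑ w : Fin m, if (SimpleGraph.turanGraph m p).Adj v w then 1 else 0 := by
      rw [two_mul_numEdges]
      congr!
    rw [hT]
    have : ∀ v w : Fin m, (if (SimpleGraph.turanGraph m p).Adj v w then 1 else 0) ≤
        (if (yGraph p u₁ u₂).Adj (some v) (some w) then 1 else 0) +
        ((if v = u₁ then if w = u₂ then 1 else 0 else 0) +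
          if v = u₂ then if w = u₁ then 1 else 0 else 0) := by
      intro v w
      by_cases hT : (SimpleGraph.turanGraph m p).Adj v w
      · by_cases hs : s(v, w) = s(u₁, u₂)
        · rcases Sym2.eq_iff.1 hs with ⟨rfl, rfl⟩ | ⟨rfl, rfl⟩ <;> simp [hT] <;> omega
        · have : (yGraph p u₁ u₂).Adj (some v) (some w) := ⟨hT, hs⟩
          rw [if_pos hT, if_pos this]
          omega
      · rw [if_neg hT]
        exact Nat.zero_le _
    refine (Finset.sum_le_sum fun v _ => Finset.sum_le_sum fun w _ => this v w).trans ?_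
    simp [Finset.sum_add_distrib]
  have hloop : (if (yGraph p u₁ u₂).Adj none none then 1 else 0) = 0 := by simp
  omega

/-- With `u₁` and `u₂` in the two smallest classes, these have sizes `⌊m/p⌋` and `⌊(m + 1)/p⌋`. -/
theorem numEdges_turanGraph_add_one_le_yGraph {p m : ℕ} (hp : 2 ≤ p) (hm : p ≤ m) {u₁ u₂ : Fin m}
    (hu : (u₁ : ℕ) % p ≠ (u₂ : ℕ) % p) (h12 : classSize p u₁ ≤ classSize p u₂)
    (hmin : ∀ w : Fin m, (w : ℕ) % p ≠ (u₁ : ℕ) % p → classSize p u₂ ≤ classSize p w) :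
    numEdges (SimpleGraph.turanGraph (m + 1) p) + 1 ≤
      numEdges (yGraph p u₁ u₂) + (m + 1) / p := by
  have hp0 : 0 < p := by omega
  have h1 := numEdges_yGraph_ge hu
  have h2 := numEdges_turanGraph_succ hp0 m
  -- The vertices `p - 1` and `p - 2` lie in the last, hence smallest, two classes.
  have ha := hmin ⟨p - 1, by omega⟩
  have hb := hmin ⟨p - 2, by omega⟩
  simp only [classSize_eq hp0, Nat.mod_eq_of_lt (show p - 1 < p by omega),
    Nat.mod_eq_of_lt (show p - 2 < p by omega)] at h1 h12 ha hb
  have h3 := Nat.mod_lt m hp0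
  have h4 : m / p ≤ (m + 1) / p := Nat.div_le_div_right (by omega)
  have h5 : p - 2 < m % p → (m + 1) / p = m / p + 1 := fun h => by
    rw [Nat.succ_div, if_pos]
    rw [Nat.dvd_iff_mod_eq_zero, Nat.add_mod, show m % p = p - 1 by omega,
      Nat.mod_eq_of_lt (show 1 < p by omega), Nat.sub_add_cancel (by omega), Nat.mod_self]
  split_ifs at * <;> omega

theorem exists_isY {p n : ℕ} (hp : 2 ≤ p) (hn : p < n) : ∃ Y : SimpleGraph (Fin n), IsY p n Y := by
  obtain ⟨m, rfl⟩ : ∃ m, n = m + 1 := ⟨n - 1, by omega⟩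
  have hne : Nonempty (Fin m) := ⟨⟨0, by omega⟩⟩
  obtain ⟨u₁, -, h1⟩ := Finset.exists_min_image (univ : Finset (Fin m)) (classSize p)
    Finset.univ_nonempty
  obtain ⟨u₂, h2, h3⟩ := Finset.exists_min_image
    ((univ : Finset (Fin m)).filter fun w : Fin m => (w : ℕ) % p ≠ (u₁ : ℕ) % p) (classSize p) (by
      by_cases h : (u₁ : ℕ) % p = 0
      · exact ⟨⟨1, by omega⟩, by simp [h, Nat.mod_eq_of_lt (show 1 < p by omega)]⟩
      · exact ⟨⟨0, by omega⟩, by simpa using Ne.symm h⟩)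
  simp only [Finset.mem_filter, Finset.mem_univ, true_and] at h2 h3
  exact ⟨(yGraph p u₁ u₂).comap (finSuccEquiv m), u₁, u₂, h2.symm, h1 _ (Finset.mem_univ _), h3,
    ⟨SimpleGraph.Iso.comap (finSuccEquiv m) _⟩⟩

theorem isY_spec {p n : ℕ} (hp : 2 ≤ p) (hn : 3 * p < n) {Y : SimpleGraph (Fin n)}
    (hY : IsY p n Y) : ¬ Y.Colorable p ∧ Y.CliqueFree (p + 1) ∧
      numEdges (SimpleGraph.turanGraph n p) + 1 ≤ numEdges Y + n / p := by
  obtain ⟨m, rfl⟩ : ∃ m, n = m + 1 := ⟨n - 1, by omega⟩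
  obtain ⟨u₁, u₂, hu, h12, hmin, ⟨e⟩⟩ := hY
  refine ⟨fun h => not_colorable_yGraph hp (by omega) u₁ u₂ ?_, ?_, ?_⟩
  · exact h.of_hom e.symm.toHom
  · exact (cliqueFree_yGraph (by omega) hu).comap ⟨e.toCopy⟩
  · rw [numEdges_congr e]
    exact numEdges_turanGraph_add_one_le_yGraph hp (by omega) hu h12 hmin

theorem theorem1p1 (p q : ℕ) (hp : 3 ≤ p) (hq : 1 ≤ q) :
    ∃ N : ℕ, ∀ n : ℕ, N ≤ n →
      (∃ Y : SimpleGraph (Fin n), IsY p n Y) ∧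
      (∀ Y : SimpleGraph (Fin n), IsY p n Y → Y ∈ extremalSet n p 1 ∧ Y ∈ extremalSet n p q) ∧
      (∀ G ∈ extremalSet n p q,
        (numEdges G : ℤ) =
          (numEdges (SimpleGraph.turanGraph n p) : ℤ) - ((n / p : ℕ) : ℤ) + 1) ∧
      extremalSet n p 1 ⊆ extremalSet n p q := by
  obtain ⟨N₁, hN₁⟩ := exists_numEdges_add_le_of_book_free p 1 hp
  obtain ⟨N₂, hN₂⟩ := exists_numEdges_add_le_of_book_free p q hp
  refine ⟨N₁ + N₂ + 3 * p + 1, fun n hn => ?_⟩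
  replace hN₁ := hN₁ n (by omega)
  replace hN₂ := hN₂ n (by omega)
  obtain ⟨Y₀, hY₀⟩ := exists_isY (p := p) (n := n) (by omega) (by omega)
  have hY : ∀ Y : SimpleGraph (Fin n), IsY p n Y → ∀ r, 1 ≤ r → Y ∈ admissible n p r := by
    intro Y hY r hr
    obtain ⟨h1, h2, -⟩ := isY_spec (by omega) (by omega) hY
    exact ⟨h1, book_free_of_cliqueFree hr h2⟩
  have hYe : ∀ Y : SimpleGraph (Fin n), IsY p n Y →
      numEdges (SimpleGraph.turanGraph n p) + 1 ≤ numEdges Y + n / p := fun Y hY =>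
    (isY_spec (by omega) (by omega) hY).2.2
  refine ⟨⟨Y₀, hY₀⟩, fun Y hYY => ⟨⟨hY Y hYY 1 le_rfl, fun H hH => ?_⟩,
    ⟨hY Y hYY q hq, fun H hH => ?_⟩⟩, fun G hG => ?_, fun G hG => ⟨⟨hG.1.1, ?_⟩, fun H hH => ?_⟩⟩
  · have := hN₁ H hH
    have := hYe Y hYY
    omega
  · have := hN₂ H hH
    have := hYe Y hYY
    omega
  · have h1 := hN₂ G hG.1
    have h2 := hG.2 Y₀ (hY Y₀ hY₀ q hq)
    have h3 := hYe Y₀ hY₀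
    omega
  · exact book_free_of_cliqueFree hq (cliqueFree_of_book_one_free hG.1.2)
  · have h1 := hN₂ H hH
    have h2 := hG.2 Y₀ (hY Y₀ hY₀ 1 le_rfl)
    have h3 := hYe Y₀ hY₀
    omega
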